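/- **Setting.** A network $\mathcal N$ is a finite undirected graph $(V,E)$ with capacities $c(e)\ge 0$, source nodes $s_1,\dots,s_\kappa\in V$ and a sink node $t\in V$. A computation DAG $\mathcal G=(\Omega,\Gamma)$ is a finite directed acyclic graph with source vertices $\omega_1,\dots,\omega_\kappa$ (exactly the vertices of in-degree $0$) and a sink vertex $\omega_p$ different from them (the only vertex of out-degree $0$). All edges leaving a vertex carry the same intermediate function; let $\Theta$ be the set of these functions (one for each vertex other than $\omega_p$), $\theta_i$ the function of $\omega_i$, $\Gamma_\theta$ the set of edges carrying $\theta$, and $w(\theta)\in\mathbb{Z}_{\ge 0}$ the number of bits of a symbol of $\theta$. The predecessors of $\theta$ are the functions carried by the edges that enter its vertex. The functions carried by edges into $\omega_p$ are the target functions (if there is only one such edge, its function is the function $f$ to be computed). **Embeddings and CALP.** An embedding $\mathcal E$ assigns to each $\gamma\in\Gamma$ a nonempty set $\mathcal E(\gamma)$ of paths of $\mathcal N$ (sequences of distinct vertices, length zero allowed) such that: (1) if $\gamma$ leaves $\omega_i$, all paths of $\mathcal E(\gamma)$ start at $s_i$; (2) if $\gamma$ enters $\omega_p$, they all end at $t$;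 (3) if the head of $\gamma'$ is the tail of $\gamma$, every path of $\mathcal E(\gamma)$ starts at the end of some path of $\mathcal E(\gamma')$; and for every $\gamma'$ that does not enter $\omega_p$, each path of $\mathcal E(\gamma')$ ends at the start of some path of $\mathcal E(\gamma)$ for some edge $\gamma$ leaving the head of $\gamma'$; (4) distinct paths of $\mathcal E(\gamma)$ have distinct ends; (5) two paths of $\mathcal E(\gamma)$ with different starts are vertex-disjoint. Let $r_{\mathcal E}(e)=\sum_{\theta\in\Theta} w(\theta)\,\mathbb 1\{e\text{ lies on a path of }\mathcal E(\gamma)\text{ for some }\gamma\in\Gamma_\theta\}$, and let $\mathbb E$ be the (finite) set of embeddings. CALP is the linear program: maximize $\sum_{\mathcal E\in\mathbb E}x(\mathcal E)$ subject to $\sum_{\mathcal E}r_{\mathcal E}(e)x(\mathcal E)\le c(e)$ for all $e\in E$ and $x\ge 0$. **Schemes and capacity.** A routing-computing scheme consists of $K\ge1$, counters $m_{u,k}^\theta\in\mathbb Z_{\ge0}$ ($u\in V$, $1\le k\le K$, $\theta\in\Theta$) and a finite sequence of events acting on the counters and on sets $\mathcal U_u\subseteq\Theta\times\{1,\dots,K\}$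 of symbols stored at the nodes $u$. Initially $\mathcal U_u=\{(\theta_i,k): s_i=u,\ 1\le k\le K\}$. An event is one of the following. (a) Computation at $u$ of $(\theta,k)$, $\theta$ not a source function: it requires $(\eta,k)\in\mathcal U_u$ and $m_{u,k}^\eta\ge1$ for all predecessors $\eta$ of $\theta$; each such $m_{u,k}^\eta$ decreases by $1$, then $u$ discards its symbols $(\gamma,k)$ with $m_{u,k}^\gamma=0$, and $(\theta,k)$ is added to $\mathcal U_u$. (b) Transmission of $(\theta,k)$ over a link $uv\in E$ from $u$ to $v$: it requires $(\theta,k)\in\mathcal U_u$ and $m_{u,k}^\theta\ge1$; $m_{u,k}^\theta$ decreases by $1$, then $u$ discards its symbols $(\gamma,k)$ with $m_{u,k}^\gamma=0$, and $(\theta,k)$ is added to $\mathcal U_v$. The node $t$ never discards symbols of target functions. At the end, $\mathcal U_t$ consists of the symbols $(\theta,k)$, $1\le k\le K$, of the target functions $\theta$, $\mathcal U_u=\emptyset$ for $u\ne t$, and all counters are $0$. If $\theta$ is transmitted $r_e^\theta$ times over $e$ (in either direction), put $N_e=\sum_\theta r_e^\theta w(\theta)$. A rate $\lambda$ is achievable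 if for every $\epsilon>0$ there is a scheme with $N_e(\lambda-\epsilon)\le K c(e)$ for all $e\in E$. The computing capacity $C(\mathcal N,\mathcal G)\in[0,\infty]$ is the supremum of the achievable rates ($0$ if there are none). **Theorem.** For every network $\mathcal N$ and computation DAG $\mathcal G$, the optimal value of CALP (its supremum in $[0,\infty]$) equals $C(\mathcal N,\mathcal G)$; if $C(\mathcal N,\mathcal G)<\infty$, the value is attained by a feasible $x$. -/

import Mathlib

open scoped ENNReal

namespace InNetwork

/-- A communication network: an undirected graph with a non-negative capacity on each link, the
source nodes `s 0, …, s (κ - 1)` and the sink node `t`. -/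
structure Network (κ : ℕ) (V : Type*) where
  graph : SimpleGraph V
  c : graph.edgeSet → ℝ
  c_nonneg : ∀ e, 0 ≤ c e
  s : Fin κ → V
  t : V

/-- A computation DAG with vertex type `Ω` and edge type `Γ`, data flowing from `tail γ` to
`head γ`. The sources are exactly the vertices of in-degree zero, the sink is the only vertex of
out-degree zero. All edges that leave a vertex `ω` carry the same intermediate function, so the
intermediate functions are indexed by the vertices other than the sink; `w` is the length in bits
of a symbol of that function. -/
structure CompDAG (κ : ℕ) (Ω Γ : Type*) where
  tail : Γ → Ω
  head : Γ → Ω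
  acyclic : ∀ ω, ¬ Relation.TransGen (fun a b => ∃ γ, tail γ = a ∧ head γ = b) ω ω
  source : Fin κ → Ω
  source_injective : Function.Injective source
  mem_range_source_iff : ∀ ω, ω ∈ Set.range source ↔ ∀ γ, head γ ≠ ω
  sink : Ω
  eq_sink_iff : ∀ ω, ω = sink ↔ ∀ γ, tail γ ≠ ω
  source_ne_sink : ∀ i, source i ≠ sink
  w : {ω : Ω // ω ≠ sink} → ℕ

variable {κ : ℕ} {V Ω Γ : Type*}

/-- The set `Θ` of intermediate functions, each named by the vertex that produces it. -/
abbrev CompDAG.Fn (G : CompDAG κ Ω Γ) : Type _ := {ω : Ω // ω ≠ G.sink}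

/-- The function produced by the `i`-th source. -/
def CompDAG.sourceFn (G : CompDAG κ Ω Γ) (i : Fin κ) : G.Fn := ⟨G.source i, G.source_ne_sink i⟩

/-- `η` is a predecessor function of `θ`: it is carried by an edge into the vertex of `θ`. -/
def CompDAG.IsPred (G : CompDAG κ Ω Γ) (η θ : G.Fn) : Prop :=
  ∃ γ, G.tail γ = η ∧ G.head γ = θ

/-- `θ` is carried by an edge into the sink. If only one edge enters the sink, this says that `θ`
is the target function `f`; in general `f` consists of all the functions that enter the sink. -/
def CompDAG.IsTarget (G : CompDAG κ Ω Γ) (θ : G.Fn) : Prop :=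
  ∃ γ, G.tail γ = θ ∧ G.head γ = G.sink

/-! ### Embeddings -/

/-- Paths in the network (sequences of distinct vertices, possibly of length zero). -/
abbrev Network.NPath (N : Network κ V) : Type _ := (u : V) × (v : V) × N.graph.Path u v

namespace Network.NPath

variable {N : Network κ V}

/-- The start node of a path. -/
def start (σ : N.NPath) : V := σ.1

/-- The end node of a path. -/
def finish (σ : N.NPath) : V := σ.2.1

/-- The set of vertices of a path. -/
def verts (σ : N.NPath) : Set V := {x | x ∈ σ.2.2.1.support}

/-- The path uses the link `e`. -/
def Uses (σ : N.NPath) (e : N.graph.edgeSet) : Prop := (e : Sym2 V) ∈ σ.2.2.1.edges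

end Network.NPath

/-- Embeddings of `G` on `N`: each edge of `G` is mapped to a nonempty set of paths. -/
structure IsEmbedding (N : Network κ V) (G : CompDAG κ Ω Γ) (E : Γ → Set N.NPath) : Prop where
  nonempty : ∀ γ, (E γ).Nonempty
  source : ∀ γ i, G.tail γ = G.source i → ∀ σ ∈ E γ, σ.start = N.s i
  sink : ∀ γ, G.head γ = G.sink → ∀ σ ∈ E γ, σ.finish = N.t
  /-- Where a function is produced, each of its predecessor functions is delivered. -/
  pred : ∀ γ γ', G.head γ' = G.tail γ → ∀ σ ∈ E γ, ∃ τ ∈ E γ', τ.finish = σ.start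
  /-- Where a function is delivered, it is used for some successor edge. -/
  succ : ∀ γ', G.head γ' ≠ G.sink → ∀ τ ∈ E γ',
    ∃ γ, G.tail γ = G.head γ' ∧ ∃ σ ∈ E γ, σ.start = τ.finish
  finish_inj : ∀ γ, ∀ σ ∈ E γ, ∀ τ ∈ E γ, σ.finish = τ.finish → σ = τ
  disjoint : ∀ γ, ∀ σ ∈ E γ, ∀ τ ∈ E γ, σ.start ≠ τ.start → Disjoint σ.verts τ.verts

/-- The set of all embeddings of `G` on `N`. -/
abbrev Embedding (N : Network κ V) (G : CompDAG κ Ω Γ) : Type _ :=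
  {E : Γ → Set N.NPath // IsEmbedding N G E}

/-- There are only finitely many embeddings. -/
noncomputable instance [Fintype V] [Fintype Γ] (N : Network κ V) (G : CompDAG κ Ω Γ) :
    Fintype (Embedding N G) := by
  classical
  haveI : Finite N.NPath := inferInstance
  exact Fintype.ofFinite _

/-- Some path for an edge that carries `θ` uses the link `e`. -/
def Embedding.Carries {N : Network κ V} {G : CompDAG κ Ω Γ} (E : Embedding N G) (θ : G.Fn)
    (e : N.graph.edgeSet) : Prop :=
  ∃ γ, G.tail γ = θ ∧ ∃ σ ∈ E.1 γ, σ.Uses e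

open Classical in
/-- The usage of the link `e` by the embedding: each function is counted at most once. -/
noncomputable def Embedding.usage [Fintype Ω] {N : Network κ V} {G : CompDAG κ Ω Γ}
    (E : Embedding N G) (e : N.graph.edgeSet) : ℕ :=
  ∑ θ : G.Fn, (if E.Carries θ e then 1 else 0) * G.w θ

/-! ### The capacity achieving linear program -/

section CALP

variable [Fintype V] [Fintype Ω] [Fintype Γ]

/-- The constraints of the packing LP. -/
structure IsCALPFeasible (N : Network κ V) (G : CompDAG κ Ω Γ) (x : Embedding N G → ℝ) :
    Prop where
  capacity : ∀ e, ∑ E, (E.usage e : ℝ) * x E ≤ N.c e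
  nonneg : ∀ E, 0 ≤ x E

/-- The optimal value of the LP; it is `⊤` if the LP is unbounded. -/
noncomputable def calpValue (N : Network κ V) (G : CompDAG κ Ω Γ) : ℝ≥0∞ :=
  ⨆ (x : Embedding N G → ℝ) (_ : IsCALPFeasible N G x), ENNReal.ofReal (∑ E, x E)

end CALP

/-! ### Routing-computing schemes -/

/-- The events of a scheme that processes the symbols with index in `Fin K`: the node `u` computes
the `k`-th symbol of `θ`, or sends it over a link to `v`. -/
inductive Event (V : Type*) (G : CompDAG κ Ω Γ) (K : ℕ)
  | compute (u : V) (θ : G.Fn) (k : Fin K) : Event V G K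
  | transmit (u v : V) (θ : G.Fn) (k : Fin K) : Event V G K

/-- The state of the network: `data u` is the set of symbols stored at `u`, and `m u θ k` is the
number of times that `u` is still going to use or transmit the `k`-th symbol of `θ`. -/
@[ext]
structure State (V : Type*) (G : CompDAG κ Ω Γ) (K : ℕ) where
  data : V → Set (G.Fn × Fin K)
  m : V → G.Fn → Fin K → ℕ

/-- The initial state: the sources hold their symbols, nothing else is present. -/
def State.init (N : Network κ V) (G : CompDAG κ Ω Γ) (K : ℕ) (m : V → G.Fn → Fin K → ℕ) :
    State V G K where
  data u := {p | ∃ i, N.s i = u ∧ p.1 = G.sourceFn i}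
  m := m

/-- The final state: the sink node holds all `K` symbols of the target function, nothing else is
present, and no use is left. -/
def State.final (N : Network κ V) (G : CompDAG κ Ω Γ) (K : ℕ) : State V G K where
  data u := {p | u = N.t ∧ G.IsTarget p.1}
  m _ _ _ := 0

/-- The symbols that `u` discards in an event on the symbol index `k`, when `m` is the updated
counter: those with index `k` of which no use is left. The sink node keeps the target symbols. -/
def discard (N : Network κ V) {G : CompDAG κ Ω Γ} {K : ℕ} (m : V → G.Fn → Fin K → ℕ) (u : V)
    (k : Fin K) : Set (G.Fn × Fin K) :=
  {p | p.2 = k ∧ m u p.1 k = 0 ∧ ¬ (u = N.t ∧ G.IsTarget p.1)}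

/-- The conditions under which an event can take place. -/
def State.Enabled (N : Network κ V) {G : CompDAG κ Ω Γ} {K : ℕ} (S : State V G K) :
    Event V G K → Prop
  | .compute u θ k => (∀ i, θ ≠ G.sourceFn i) ∧
      ∀ η, G.IsPred η θ → (η, k) ∈ S.data u ∧ 0 < S.m u η k
  | .transmit u v θ k => N.graph.Adj u v ∧ (θ, k) ∈ S.data u ∧ 0 < S.m u θ k

open Classical in
/-- The counters after an event. -/
noncomputable def State.nextM {G : CompDAG κ Ω Γ} {K : ℕ} (S : State V G K) :
    Event V G K → V → G.Fn → Fin K → ℕ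
  | .compute u θ k => fun x η j =>
      if x = u ∧ j = k ∧ G.IsPred η θ then S.m x η j - 1 else S.m x η j
  | .transmit u _ θ k => fun x η j =>
      if x = u ∧ j = k ∧ η = θ then S.m x η j - 1 else S.m x η j

open Classical in
/-- The stored symbols after an event. -/
noncomputable def State.nextData (N : Network κ V) {G : CompDAG κ Ω Γ} {K : ℕ}
    (S : State V G K) (ev : Event V G K) : V → Set (G.Fn × Fin K) :=
  match ev with
  | .compute u θ k => fun x =>
      if x = u then {(θ, k)} ∪ (S.data u \ discard N (S.nextM ev) u k) else S.data x
  | .transmit u v θ k => fun x =>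
      if x = u then S.data u \ discard N (S.nextM ev) u k
      else if x = v then S.data v ∪ {(θ, k)} else S.data x

/-- The state after an event. -/
noncomputable def State.next (N : Network κ V) {G : CompDAG κ Ω Γ} {K : ℕ} (S : State V G K)
    (ev : Event V G K) : State V G K where
  data := S.nextData N ev
  m := S.nextM ev

/-- `Run N S l S'`: the events of the list `l` can take place one after the other, starting in the
state `S`, and they end in the state `S'`. -/
inductive Run (N : Network κ V) {G : CompDAG κ Ω Γ} {K : ℕ} :
    State V G K → List (Event V G K) → State V G K → Prop
  | nil (S : State V G K) : Run N S [] S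
  | cons {S S' : State V G K} {ev : Event V G K} {l : List (Event V G K)}
      (h : S.Enabled N ev) (hl : Run N (S.next N ev) l S') : Run N S (ev :: l) S'

/-- A routing-computing scheme: a block length `K ≥ 1`, the numbers `m u θ k` of uses and
transmissions of the `k`-th symbol of `θ` by `u`, and a sequence of events that leads from the
initial to the final state. -/
structure Scheme (N : Network κ V) (G : CompDAG κ Ω Γ) where
  K : ℕ
  K_pos : 0 < K
  m : V → G.Fn → Fin K → ℕ
  events : List (Event V G K)
  run : Run N (State.init N G K m) events (State.final N G K)

/-- The event is a transmission of `θ` over the link `e`, in either direction. -/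
def Event.Sends {G : CompDAG κ Ω Γ} {K : ℕ} (ev : Event V G K) (θ : G.Fn) (e : Sym2 V) : Prop :=
  ∃ u v k, ev = .transmit u v θ k ∧ s(u, v) = e

open Classical in
/-- The total link usage `N_e` of a scheme, in bits. -/
noncomputable def Scheme.linkUsage [Fintype Ω] {N : Network κ V} {G : CompDAG κ Ω Γ}
    (A : Scheme N G) (e : N.graph.edgeSet) : ℕ :=
  ∑ θ : G.Fn, A.events.countP (fun ev => ev.Sends θ e) * G.w θ

/-- Achievable rates. -/
def Achievable [Fintype Ω] (N : Network κ V) (G : CompDAG κ Ω Γ) (r : ℝ) : Prop :=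
  ∀ ε : ℝ, 0 < ε → ∃ A : Scheme N G, ∀ e, (A.linkUsage e : ℝ) * (r - ε) ≤ A.K * N.c e

/-- The computing capacity: the supremum in `[0, ∞]` of the achievable rates. -/
noncomputable def computingCapacity [Fintype Ω] (N : Network κ V) (G : CompDAG κ Ω Γ) : ℝ≥0∞ :=
  ⨆ (r : ℝ) (_ : Achievable N G r), ENNReal.ofReal r

end InNetwork

/-! Both inequalities rest on a dictionary between an embedding and the events that process one
symbol index. Counters and discarding are stripped away first: in a `Derivation` every input is an
initial symbol or an earlier output. Runs are derivations (`Run.derivation`). Conversely,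
`Derivation.exists_scheme` deletes useless events and takes as counter of a symbol the number of
events that read it, so that nothing is discarded too early and nothing is left over.

From embeddings to schemes: in an order compatible with the DAG, each function is computed at the
starts of its paths and then spread over the links of these paths, with at most one transmission per
link. Index `k` thus costs at most the usage of its embedding. A feasible `x` is approximated by
using each embedding `⌊M * x E⌋₊` times, with `M` large.

From schemes to embeddings: `Provenance` records the path on which each symbol first reached a node.
For a fixed function and index these paths form a forest. Working back from the sink, `Demand`
selects the paths that are needed, and these form an embedding (`Provenance.isEmbedding`). Every
link on them was crossed by a transmission with that index, so weight `r / K` on each of the `K`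
embeddings is feasible.

If the value is finite, every embedding uses some link, so the feasible set is compact and the
maximum is attained. -/

namespace InNetwork

variable {κ : ℕ} {V Ω Γ : Type*} {N : Network κ V} {G : CompDAG κ Ω Γ} {K : ℕ}

/-! ### Derivations

A symbol at a node is an element of `V × G.Fn × Fin K`. We first study sequences of events in which
symbols are never discarded. -/

/-- The symbols that an event reads. -/
def Event.inputs : Event V G K → Set (V × G.Fn × Fin K)
  | .compute u θ k => {p | p.1 = u ∧ p.2.2 = k ∧ G.IsPred p.2.1 θ}
  | .transmit u _ θ k => {p | p.1 = u ∧ p.2.2 = k ∧ p.2.1 = θ}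

/-- The symbol that an event makes available. -/
def Event.output : Event V G K → V × G.Fn × Fin K
  | .compute u θ k => (u, θ, k)
  | .transmit _ v θ k => (v, θ, k)

/-- The symbol index of an event. -/
def Event.index : Event V G K → Fin K
  | .compute _ _ k => k
  | .transmit _ _ _ k => k

/-- The part of `State.Enabled` that does not refer to the state. -/
def Event.Legal (N : Network κ V) : Event V G K → Prop
  | .compute _ θ _ => ∀ i, θ ≠ G.sourceFn i
  | .transmit u v _ _ => N.graph.Adj u v

/-- Every event of the list reads only symbols of `B` and outputs of earlier events. -/
def Derivation (N : Network κ V) : Set (V × G.Fn × Fin K) → List (Event V G K) → Prop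
  | _, [] => True
  | B, ev :: l => ev.Legal N ∧ ev.inputs ⊆ B ∧ Derivation N (insert ev.output B) l

/-- The symbols that are available after the events of a list. -/
def avail (B : Set (V × G.Fn × Fin K)) (l : List (Event V G K)) : Set (V × G.Fn × Fin K) :=
  B ∪ {p | ∃ ev ∈ l, ev.output = p}

theorem avail_nil (B : Set (V × G.Fn × Fin K)) : avail B [] = B := by
  simp [avail]

theorem avail_cons (B : Set (V × G.Fn × Fin K)) (ev : Event V G K) (l : List (Event V G K)) :
    avail B (ev :: l) = avail (insert ev.output B) l := by
  ext p
  simp only [avail, List.mem_cons, Set.mem_union, Set.mem_ofPred_eq, exists_eq_or_imp,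
    Set.mem_insert_iff]
  rw [@eq_comm _ p]
  tauto

theorem avail_append (B : Set (V × G.Fn × Fin K)) (l l' : List (Event V G K)) :
    avail B (l ++ l') = avail (avail B l) l' := by
  ext p
  simp only [avail, List.mem_append, Set.mem_union, Set.mem_ofPred_eq, or_and_right, exists_or, or_assoc]

theorem subset_avail (B : Set (V × G.Fn × Fin K)) (l : List (Event V G K)) : B ⊆ avail B l :=
  Set.subset_union_left

theorem Derivation.append {B : Set (V × G.Fn × Fin K)} {l l' : List (Event V G K)}
    (h : Derivation N B l) (h' : Derivation N (avail B l) l') : Derivation N B (l ++ l') := by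
  induction l generalizing B with
  | nil => simpa [avail_nil] using h'
  | cons ev l ih => exact ⟨h.1, h.2.1, ih h.2.2 (by rwa [← avail_cons])⟩

theorem Derivation.of_forall {B : Set (V × G.Fn × Fin K)} {l : List (Event V G K)}
    (h : ∀ ev ∈ l, ev.Legal N ∧ ev.inputs ⊆ B) : Derivation N B l := by
  induction l generalizing B with
  | nil => trivial
  | cons ev l ih =>
    refine ⟨(h ev (by simp)).1, (h ev (by simp)).2, ih fun ev' hev' => ?_⟩
    have := h ev' (by simp [hev'])
    exact ⟨this.1, this.2.trans (Set.subset_insert _ _)⟩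

theorem Derivation.legal {B : Set (V × G.Fn × Fin K)} {l : List (Event V G K)}
    (h : Derivation N B l) {ev : Event V G K} (hev : ev ∈ l) : ev.Legal N := by
  induction l generalizing B with
  | nil => simp at hev
  | cons ev' l ih =>
    rcases List.mem_cons.1 hev with rfl | hev
    · exact h.1
    · exact ih h.2.2 hev

/-- Inputs of a derivation are available at its end. -/
theorem Derivation.inputs_subset {B : Set (V × G.Fn × Fin K)} {l : List (Event V G K)}
    (h : Derivation N B l) {ev : Event V G K} (hev : ev ∈ l) : ev.inputs ⊆ avail B l := by
  induction l generalizing B with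
  | nil => simp at hev
  | cons ev' l ih =>
    rcases List.mem_cons.1 hev with rfl | hev
    · exact h.2.1.trans (subset_avail _ _)
    · rw [avail_cons]
      exact ih h.2.2 hev

/-- The events of a run form a derivation. -/
theorem Run.derivation {S S' : State V G K} {l : List (Event V G K)} (h : Run N S l S')
    {B : Set (V × G.Fn × Fin K)} (hB : ∀ x, ∀ p ∈ S.data x, (x, p) ∈ B) :
    Derivation N B l ∧ ∀ x, ∀ p ∈ S'.data x, (x, p) ∈ avail B l := by
  induction h generalizing B with
  | nil S => exact ⟨trivial, fun x p hp => by simpa [avail_nil] using hB x p hp⟩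
  | @cons S S' ev l h hl ih =>
    have key : ∀ x, ∀ p ∈ (S.next N ev).data x, (x, p) ∈ insert ev.output B := by
      intro x p hp
      cases ev with
      | compute u θ k =>
        simp only [State.next, State.nextData] at hp
        split_ifs at hp with hx
        · subst hx
          rcases hp with hp | hp
          · left
            rw [Set.mem_singleton_iff.1 hp]
            rfl
          · exact Or.inr (hB _ _ hp.1)
        · exact Or.inr (hB _ _ hp)
      | transmit u v θ k =>
        simp only [State.next, State.nextData] at hp
        split_ifs at hp with hx hx'
        · subst hx
          exact Or.inr (hB _ _ hp.1)
        · subst hx'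
          rcases hp with hp | hp
          · exact Or.inr (hB _ _ hp)
          · left
            rw [Set.mem_singleton_iff.1 hp]
            rfl
        · exact Or.inr (hB _ _ hp)
    obtain ⟨h₁, h₂⟩ := ih key
    refine ⟨⟨?_, ?_, h₁⟩, fun x p hp => by simpa [avail_cons] using h₂ x p hp⟩
    · cases ev with
      | compute u θ k => exact h.1
      | transmit u v θ k => exact h.1
    · cases ev with
      | compute u θ k =>
        rintro ⟨x, η, j⟩ ⟨rfl, rfl, hη⟩
        exact hB _ _ (h.2 η hη).1
      | transmit u v θ k =>
        rintro ⟨x, η, j⟩ ⟨rfl, rfl, rfl⟩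
        exact hB _ _ h.2.1

/-! ### Runs from derivations -/

open Classical in
/-- The number of events of the list that read the symbol `p`. -/
noncomputable def uses (l : List (Event V G K)) (p : V × G.Fn × Fin K) : ℕ :=
  l.countP fun ev => p ∈ ev.inputs

open Classical in
theorem uses_cons (ev : Event V G K) (l : List (Event V G K)) (p : V × G.Fn × Fin K) :
    uses (ev :: l) p = uses l p + if p ∈ ev.inputs then 1 else 0 := by
  simp [uses, List.countP_cons]

theorem uses_pos_iff {l : List (Event V G K)} {p : V × G.Fn × Fin K} :
    0 < uses l p ↔ ∃ ev ∈ l, p ∈ ev.inputs := by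
  simp [uses, List.countP_pos_iff]

/-- The output of every event is in `T`, or is read by a later event. -/
def Useful (T : Set (V × G.Fn × Fin K)) : List (Event V G K) → Prop
  | [] => True
  | ev :: l => (ev.output ∈ T ∨ 0 < uses l ev.output) ∧ Useful T l

/-- A symbol that no event reads can be removed from the initial ones. -/
theorem Derivation.of_insert {B : Set (V × G.Fn × Fin K)} {p : V × G.Fn × Fin K}
    {l : List (Event V G K)} (h : Derivation N (insert p B) l) (hp : ¬ 0 < uses l p) :
    Derivation N B l := by
  induction l generalizing B with
  | nil => trivial
  | cons ev l ih =>
    rw [uses_pos_iff] at hp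
    push Not at hp
    refine ⟨h.1, fun q hq => (h.2.1 hq).resolve_left ?_, ih ?_ ?_⟩
    · rintro rfl
      exact hp ev (by simp) hq
    · rw [Set.insert_comm]
      exact h.2.2
    · rw [uses_pos_iff]
      push Not
      exact fun ev' hmem => hp ev' (by simp [hmem])

/-- Useless events can be removed from a derivation. -/
theorem Derivation.exists_useful {B T : Set (V × G.Fn × Fin K)} {l : List (Event V G K)}
    (h : Derivation N B l) (hT : T ⊆ avail B l) :
    ∃ l', List.Sublist l' l ∧ Derivation N B l' ∧ T ⊆ avail B l' ∧ Useful T l' := by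
  induction l generalizing B with
  | nil => exact ⟨[], List.Sublist.refl _, h, hT, trivial⟩
  | cons ev l ih =>
    rw [avail_cons] at hT
    obtain ⟨l', hs, hd, hT', hu⟩ := ih h.2.2 hT
    by_cases hev : ev.output ∈ T ∨ 0 < uses l' ev.output
    · exact ⟨ev :: l', hs.cons_cons ev, ⟨h.1, h.2.1, hd⟩, by rwa [avail_cons], hev, hu⟩
    · push Not at hev
      -- The output is neither a target nor read later, so dropping the event deprives no later
      -- event of an input.
      refine ⟨l', hs.cons ev, hd.of_insert (by have := hev.2; omega), fun p hp => ?_, hu⟩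
      rcases hT' hp with (rfl | hp') | hp'
      · exact absurd hp hev.1
      · exact Or.inl hp'
      · exact Or.inr hp'

/-- The symbols of the target functions at the sink node. -/
def targets (N : Network κ V) (G : CompDAG κ Ω Γ) (K : ℕ) : Set (V × G.Fn × Fin K) :=
  {p | p.1 = N.t ∧ G.IsTarget p.2.1}

/-- The symbols that are present initially. -/
def sources (N : Network κ V) (G : CompDAG κ Ω Γ) (K : ℕ) : Set (V × G.Fn × Fin K) :=
  {p | ∃ i, N.s i = p.1 ∧ p.2.1 = G.sourceFn i}

/-- The state in which the symbols of `B` have been made available and the events of `l` are still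
to come. -/
noncomputable def stateBefore (N : Network κ V) (B : Set (V × G.Fn × Fin K))
    (l : List (Event V G K)) : State V G K where
  data x := {p | (x, p) ∈ B ∧ ((x, p) ∈ targets N G K ∨ 0 < uses l (x, p))}
  m x θ k := uses l (x, θ, k)

theorem nextM_stateBefore (B : Set (V × G.Fn × Fin K)) (ev : Event V G K)
    (l : List (Event V G K)) (x : V) (θ : G.Fn) (k : Fin K) :
    (stateBefore N B (ev :: l)).nextM ev x θ k = uses l (x, θ, k) := by
  classical
  by_cases h : (x, θ, k) ∈ ev.inputs
  · have : (stateBefore N B (ev :: l)).nextM ev x θ k = uses (ev :: l) (x, θ, k) - 1 := by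
      cases ev <;> exact if_pos h
    simp [this, uses_cons, h]
  · have : (stateBefore N B (ev :: l)).nextM ev x θ k = uses (ev :: l) (x, θ, k) := by
      cases ev <;> exact if_neg h
    simp [this, uses_cons, h]

/-- A counter is the number of coming events that read the symbol, so exactly those non-target
symbols are discarded whose last reader has just acted. By `hev` the new symbol is one that the
state on the right keeps: a target, or a symbol still to be read. -/
theorem next_stateBefore (B : Set (V × G.Fn × Fin K)) (ev : Event V G K)
    (l : List (Event V G K)) (hl : ev.Legal N)
    (hev : ev.output ∈ targets N G K ∨ 0 < uses l ev.output) :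
    (stateBefore N B (ev :: l)).next N ev = stateBefore N (insert ev.output B) l := by
  classical
  have hm := nextM_stateBefore (N := N) B ev l
  have hle : ∀ q, uses l q ≤ uses (ev :: l) q := fun q => by simp [uses_cons]
  ext x p
  · have hT : (x, p) ∈ targets N G K ↔ x = N.t ∧ G.IsTarget p.1 := Iff.rfl
    have hm' : (stateBefore N B (ev :: l)).nextM ev x p.1 p.2 = uses l (x, p) := hm x p.1 p.2
    have hle' := hle (x, p)
    cases ev with
    | compute u θ k =>
      have hne : x ≠ u ∨ p.2 ≠ k → uses (.compute u θ k :: l) (x, p) = uses l (x, p) := by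
        intro h
        rw [uses_cons, if_neg, add_zero]
        rintro ⟨h₁, h₂, -⟩
        exact h.elim (absurd h₁) (absurd h₂)
      simp only [State.next, State.nextData, Event.output] at hev ⊢
      by_cases hx : x = u
      · subst hx
        simp only [if_true, stateBefore, discard, Set.mem_union, Set.mem_singleton_iff,
          Set.mem_sdiff, Set.mem_ofPred_eq, Set.mem_insert_iff, Prod.mk.injEq, true_and] at hm' ⊢
        grind
      · simp only [if_false, stateBefore, Set.mem_ofPred_eq, Set.mem_insert_iff, Prod.mk.injEq,
          hx, false_and, false_or, hne (Or.inl hx)]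
    | transmit u v θ k =>
      -- A link joins distinct nodes, so the removals at `u` and the insertion at `v` do not
      -- interact.
      have huv : u ≠ v := SimpleGraph.Adj.ne hl
      have hne : x ≠ u ∨ p.2 ≠ k → uses (.transmit u v θ k :: l) (x, p) = uses l (x, p) := by
        intro h
        rw [uses_cons, if_neg, add_zero]
        rintro ⟨h₁, h₂, -⟩
        exact h.elim (absurd h₁) (absurd h₂)
      simp only [State.next, State.nextData, Event.output] at hev ⊢
      by_cases hx : x = u
      · subst hx
        simp only [if_true, stateBefore, discard, Set.mem_sdiff, Set.mem_ofPred_eq,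
          Set.mem_insert_iff, Prod.mk.injEq, huv, false_and, false_or] at hm' ⊢
        grind
      · have hne' := hne (Or.inl hx)
        by_cases hx' : x = v
        · subst hx'
          simp only [if_neg hx, if_true, stateBefore, Set.mem_union, Set.mem_singleton_iff,
            Set.mem_ofPred_eq, Set.mem_insert_iff, Prod.mk.injEq, true_and, hne']
          grind
        · simp only [if_neg hx, if_false, stateBefore, Set.mem_ofPred_eq, Set.mem_insert_iff,
            Prod.mk.injEq, hx', false_and, false_or, hne']
  · exact hm x p _

theorem run_stateBefore {B : Set (V × G.Fn × Fin K)} {l : List (Event V G K)}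
    (h : Derivation N B l) (hu : Useful (targets N G K) l) (hT : targets N G K ⊆ avail B l) :
    Run N (stateBefore N B l) l (State.final N G K) := by
  induction l generalizing B with
  | nil =>
    rw [avail_nil] at hT
    convert Run.nil _ using 1
    ext x p
    · simp only [State.final, stateBefore, Set.mem_ofPred_eq, uses, List.countP_nil, lt_irrefl,
        or_false]
      exact ⟨fun h => ⟨hT (show (x, p) ∈ targets N G K from h), h⟩, fun h => h.2⟩
    · rfl
  | cons ev l ih =>
    refine Run.cons ?_ ?_
    · have hpos : ∀ q ∈ ev.inputs, q ∈ B ∧ 0 < uses (ev :: l) q := fun q hq =>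
        ⟨h.2.1 hq, uses_pos_iff.2 ⟨ev, by simp, hq⟩⟩
      cases ev with
      | compute u θ k =>
        refine ⟨h.1, fun η hη => ?_⟩
        have := hpos (u, η, k) ⟨rfl, rfl, hη⟩
        exact ⟨⟨this.1, Or.inr this.2⟩, this.2⟩
      | transmit u v θ k =>
        have := hpos (u, θ, k) ⟨rfl, rfl, rfl⟩
        exact ⟨h.1, ⟨this.1, Or.inr this.2⟩, this.2⟩
    · rw [next_stateBefore B ev l h.1 hu.1]
      exact ih h.2.2 hu.2 (by rwa [← avail_cons])

/-! ### Order of the computation DAG -/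

/-- The function carried by an edge. -/
def CompDAG.tailFn (G : CompDAG κ Ω Γ) (γ : Γ) : G.Fn :=
  ⟨G.tail γ, fun h => (G.eq_sink_iff _).1 h γ rfl⟩

theorem CompDAG.wellFounded [Finite Ω] (G : CompDAG κ Ω Γ) :
    WellFounded fun a b => ∃ γ, G.tail γ = a ∧ G.head γ = b := by
  have : Std.Irrefl (Relation.TransGen fun a b => ∃ γ, G.tail γ = a ∧ G.head γ = b) :=
    ⟨G.acyclic⟩
  exact Subrelation.wf (fun h => Relation.TransGen.single h)
    (Finite.wellFounded_of_trans_of_irrefl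
      (Relation.TransGen fun a b => ∃ γ, G.tail γ = a ∧ G.head γ = b))

theorem CompDAG.wellFounded_swap [Finite Ω] (G : CompDAG κ Ω Γ) :
    WellFounded fun b a => ∃ γ, G.tail γ = a ∧ G.head γ = b := by
  have : Std.Irrefl (Function.swap
      (Relation.TransGen fun a b => ∃ γ, G.tail γ = a ∧ G.head γ = b)) := ⟨G.acyclic⟩
  exact Subrelation.wf (fun h => Relation.TransGen.single h)
    (Finite.wellFounded_of_trans_of_irrefl
      (Function.swap (Relation.TransGen fun a b => ∃ γ, G.tail γ = a ∧ G.head γ = b)))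

theorem CompDAG.head_ne_source (G : CompDAG κ Ω Γ) (γ : Γ) (i : Fin κ) :
    G.head γ ≠ G.source i :=
  (G.mem_range_source_iff _).1 ⟨i, rfl⟩ γ

theorem CompDAG.exists_tail_eq (G : CompDAG κ Ω Γ) (θ : G.Fn) : ∃ γ, G.tail γ = θ := by
  by_contra h
  push Not at h
  exact θ.2 ((G.eq_sink_iff _).2 h)

/-! ### In a complete derivation all sources are used -/

/-- Trace the symbol back along transmissions, each of which reads the same symbol at its sender.
The trace ends at a computation or at an initial symbol. -/
theorem Derivation.origin {B : Set (V × G.Fn × Fin K)} {l : List (Event V G K)}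
    (h : Derivation N B l) {v : V} {θ : G.Fn} {k : Fin K} (hv : (v, θ, k) ∈ avail B l) :
    (v, θ, k) ∈ B ∨ (∃ u, .compute u θ k ∈ l) ∨ ∃ u, (u, θ, k) ∈ B ∧ 0 < uses l (u, θ, k) := by
  induction l generalizing B with
  | nil => exact Or.inl (by rwa [avail_nil] at hv)
  | cons ev l ih =>
    have hout : ∀ u, (u, θ, k) = ev.output → (∃ u, .compute u θ k ∈ ev :: l) ∨
        ∃ u, (u, θ, k) ∈ B ∧ 0 < uses (ev :: l) (u, θ, k) := by
      intro u hu
      cases ev with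
      | compute u' θ' k' =>
        simp only [Event.output, Prod.mk.injEq] at hu
        obtain ⟨rfl, rfl, rfl⟩ := hu
        exact Or.inl ⟨u, by simp⟩
      | transmit u' v' θ' k' =>
        simp only [Event.output, Prod.mk.injEq] at hu
        obtain ⟨rfl, rfl, rfl⟩ := hu
        exact Or.inr ⟨u', h.2.1 ⟨rfl, rfl, rfl⟩,
          uses_pos_iff.2 ⟨_, List.mem_cons_self, ⟨rfl, rfl, rfl⟩⟩⟩
    rw [avail_cons] at hv
    rcases ih h.2.2 hv with (hv | hv) | ⟨u, hu⟩ | ⟨u, hu | hu, hpos⟩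
    · exact Or.inr (hout _ hv)
    · exact Or.inl hv
    · exact Or.inr (Or.inl ⟨u, List.mem_cons_of_mem _ hu⟩)
    · exact Or.inr (hout _ hu)
    · refine Or.inr (Or.inr ⟨u, hu, ?_⟩)
      rw [uses_cons]
      omega

/-- Induction from the sink towards the sources. An edge that carries `θ` either enters the sink or
leads to a function that is used somewhere. The latter is not a source function, so it was computed
at some node, and that computation read `θ`. -/
theorem Derivation.exists_used [Finite Ω] {l : List (Event V G K)}
    (h : Derivation N (sources N G K) l) (hT : targets N G K ⊆ avail (sources N G K) l)
    (θ : G.Fn) (k : Fin K) : ∃ v, (v, θ, k) ∈ targets N G K ∨ 0 < uses l (v, θ, k) := by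
  obtain ⟨ω, hω⟩ := θ
  induction ω using G.wellFounded_swap.induction with
  | _ ω ih =>
  obtain ⟨γ, hγ⟩ := G.exists_tail_eq ⟨ω, hω⟩
  by_cases hs : G.head γ = G.sink
  · exact ⟨N.t, Or.inl ⟨rfl, γ, hγ, hs⟩⟩
  · obtain ⟨v, hv⟩ := ih (G.head γ) ⟨γ, hγ, rfl⟩ hs
    have hav : (v, ⟨G.head γ, hs⟩, k) ∈ avail (sources N G K) l := by
      rcases hv with hv | hv
      · exact hT hv
      · obtain ⟨ev, hev, hin⟩ := uses_pos_iff.1 hv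
        exact h.inputs_subset hev hin
    have hns : ∀ u, (u, ⟨G.head γ, hs⟩, k) ∉ sources N G K := by
      rintro u ⟨i, -, hi⟩
      exact G.head_ne_source γ i (congrArg Subtype.val hi)
    rcases h.origin hav with h' | ⟨u, hu⟩ | ⟨u, hu, -⟩
    · exact absurd h' (hns _)
    · exact ⟨u, Or.inr (uses_pos_iff.2 ⟨_, hu, ⟨rfl, rfl, γ, hγ, rfl⟩⟩)⟩
    · exact absurd hu (hns _)

/-- Needed because `State.init` holds all source symbols, while `stateBefore` keeps only targets and
symbols still to be read. A source function is used somewhere and never computed, so its trace leads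
to the only node that holds it initially. -/
theorem Derivation.sources_used [Finite Ω] {l : List (Event V G K)}
    (h : Derivation N (sources N G K) l) (hT : targets N G K ⊆ avail (sources N G K) l)
    {p : V × G.Fn × Fin K} (hp : p ∈ sources N G K) : p ∈ targets N G K ∨ 0 < uses l p := by
  obtain ⟨x, θ, k⟩ := p
  obtain ⟨i, hi, hθ⟩ := hp
  dsimp only at hi hθ
  have huniq : ∀ u, (u, θ, k) ∈ sources N G K → u = x := by
    rintro u ⟨j, hj, hθj⟩
    dsimp only at hj hθj
    have : i = j := G.source_injective (congrArg Subtype.val (hθ.symm.trans hθj))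
    rw [← hj, ← hi, this]
  obtain ⟨v, hv⟩ := h.exists_used hT θ k
  have hav : (v, θ, k) ∈ avail (sources N G K) l := by
    rcases hv with hv | hv
    · exact hT hv
    · obtain ⟨ev, hev, hin⟩ := uses_pos_iff.1 hv
      exact h.inputs_subset hev hin
  rcases h.origin hav with h' | ⟨u, hu⟩ | ⟨u, hu, hpos⟩
  · rwa [huniq v h'] at hv
  · exact absurd hθ (h.legal hu i)
  · rw [huniq u hu] at hpos
    exact Or.inr hpos

open Classical in
/-- A derivation of all target symbols yields a scheme that sends at most as much. -/
theorem Derivation.exists_scheme [Finite Ω] {l : List (Event V G K)} (hK : 0 < K)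
    (h : Derivation N (sources N G K) l) (hT : targets N G K ⊆ avail (sources N G K) l) :
    ∃ A : Scheme N G, A.K = K ∧ ∀ (θ : G.Fn) (e : Sym2 V),
      A.events.countP (fun ev => ev.Sends θ e) ≤ l.countP fun ev => ev.Sends θ e := by
  obtain ⟨l', hs, hd, hT', hu⟩ := h.exists_useful hT
  refine ⟨⟨K, hK, fun x θ k => uses l' (x, θ, k), l', ?_⟩, rfl, fun θ e => hs.countP_le⟩
  convert run_stateBefore hd hu hT' using 1
  ext x p
  · exact ⟨fun hp => ⟨hp, hd.sources_used hT' hp⟩, fun hp => hp.1⟩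
  · rfl

/-! ### Derivations from embeddings -/

open Classical in
/-- A symbol can be spread over a set of links, using each of them at most once. -/
theorem exists_spread (θ : G.Fn) (k : Fin K) (H : Finset (Sym2 V))
    (hH : ∀ e ∈ H, e ∈ N.graph.edgeSet) (B : Set (V × G.Fn × Fin K)) :
    ∃ l : List (Event V G K), Derivation N B l ∧
      (∀ θ' e, l.countP (fun ev => ev.Sends θ' e) ≤ if θ' = θ ∧ e ∈ H then 1 else 0) ∧
      ∀ u v, s(u, v) ∈ H → (u, θ, k) ∈ avail B l → (v, θ, k) ∈ avail B l := by
  induction H using Finset.strongInduction generalizing B with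
  | H H ih =>
  by_cases hcl : ∀ u v, s(u, v) ∈ H → (u, θ, k) ∈ B → (v, θ, k) ∈ B
  · exact ⟨[], trivial, by simp, by simpa [avail_nil] using hcl⟩
  push Not at hcl
  obtain ⟨u, v, huv, hu, hv⟩ := hcl
  -- After the transmission both ends of this link hold the symbol, so the link never has to be used
  -- again and leaves `H`.
  obtain ⟨l, hd, hc, hl⟩ := ih (H.erase s(u, v)) (Finset.erase_ssubset huv)
    (fun e he => hH e (Finset.mem_of_mem_erase he)) (insert (v, θ, k) B)
  refine ⟨.transmit u v θ k :: l, ⟨hH _ huv, ?_, hd⟩, ?_, ?_⟩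
  · rintro ⟨x, η, j⟩ ⟨rfl, rfl, rfl⟩
    exact hu
  · intro θ' e
    rw [List.countP_cons]
    have h₁ := hc θ' e
    by_cases hs : (Event.transmit u v θ k : Event V G K).Sends θ' e
    · obtain ⟨u', v', k', heq, he⟩ := hs
      simp only [Event.transmit.injEq] at heq
      obtain ⟨rfl, rfl, rfl, rfl⟩ := heq
      subst he
      simp only [Finset.mem_erase, ne_eq, not_true, false_and, and_false, if_false] at h₁
      simp only [huv, and_self, if_true]
      split_ifs <;> omega
    · simp only [hs, decide_false, Bool.false_eq_true, if_false, add_zero]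
      refine h₁.trans ?_
      split_ifs with h₂ h₃ <;> simp_all
  · intro a b hab ha
    rw [avail_cons] at ha ⊢
    by_cases he : s(a, b) = s(u, v)
    · apply subset_avail
      rcases Sym2.eq_iff.1 he with ⟨rfl, rfl⟩ | ⟨rfl, rfl⟩
      · exact Set.mem_insert _ _
      · exact Set.mem_insert_of_mem _ hu
    · exact hl a b (Finset.mem_erase.2 ⟨he, hab⟩) ha

theorem walk_closed {D : Set V} {H : Set (Sym2 V)}
    (hD : ∀ u v, s(u, v) ∈ H → u ∈ D → v ∈ D) {a b : V} (p : N.graph.Walk a b)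
    (hp : ∀ e ∈ p.edges, e ∈ H) (ha : a ∈ D) : b ∈ D := by
  induction p with
  | nil => exact ha
  | @cons a c b h p ih =>
    simp only [SimpleGraph.Walk.edges_cons, List.mem_cons, forall_eq_or_imp] at hp
    exact ih hp.2 (hD _ _ hp.1 ha)

-- The condition `pred` brings all inputs of `θ` to the start of each of its paths, where it can be
-- computed; source symbols are at hand by `hB`. Spreading over the union of the links of all paths
-- for `θ` reaches their ends, and a link shared by several edges that carry `θ` is paid for once.
open Classical in
theorem Embedding.exists_derivation_extend [Fintype V] (E : Embedding N G) (k : Fin K)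
    {B : Set (V × G.Fn × Fin K)} (hB : ∀ i, (N.s i, G.sourceFn i, k) ∈ B) (θ : G.Fn)
    (hpred : ∀ γ, G.head γ = θ → ∀ σ ∈ E.1 γ, (σ.finish, G.tailFn γ, k) ∈ B) :
    ∃ l : List (Event V G K), Derivation N B l ∧
      (∀ γ, G.tail γ = θ → ∀ σ ∈ E.1 γ, (σ.finish, θ, k) ∈ avail B l) ∧
      ∀ θ' (e : N.graph.edgeSet), l.countP (fun ev => ev.Sends θ' e) ≤
        if θ' = θ ∧ E.Carries θ' e then 1 else 0 := by
  obtain ⟨l₁, hd₁, hst, hc₁⟩ : ∃ l : List (Event V G K), Derivation N B l ∧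
      (∀ γ, G.tail γ = θ → ∀ σ ∈ E.1 γ, (σ.start, θ, k) ∈ avail B l) ∧
      ∀ ev ∈ l, ∀ θ' e, ¬ ev.Sends θ' e := by
    by_cases hθ : ∃ i, θ = G.sourceFn i
    · obtain ⟨i, rfl⟩ := hθ
      refine ⟨[], trivial, fun γ hγ σ hσ => ?_, by simp⟩
      rw [avail_nil, E.2.source γ i hγ σ hσ]
      exact hB i
    · push Not at hθ
      let St : Finset V := Finset.univ.filter fun u => ∃ γ, G.tail γ = θ ∧ ∃ σ ∈ E.1 γ, σ.start = u
      refine ⟨St.toList.map fun u => .compute u θ k, Derivation.of_forall ?_, ?_, ?_⟩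
      · intro ev hev
        obtain ⟨u, hu, rfl⟩ := List.mem_map.1 hev
        refine ⟨hθ, ?_⟩
        rintro ⟨x, η, j⟩ ⟨hx, hj, γ', hγ', hγ''⟩
        dsimp only at hx hj hγ' hγ''
        subst hx hj
        obtain ⟨γ, hγ, σ, hσ, hst⟩ := (Finset.mem_filter.1 (Finset.mem_toList.1 hu)).2
        obtain ⟨τ, hτ, hfin⟩ := E.2.pred γ γ' (hγ''.trans hγ.symm) σ hσ
        have := hpred γ' hγ'' τ hτ
        rwa [hfin, hst, show G.tailFn γ' = η from Subtype.ext hγ'] at this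
      · intro γ hγ σ hσ
        refine Or.inr ⟨.compute σ.start θ k, List.mem_map.2 ⟨σ.start, ?_, rfl⟩, rfl⟩
        exact Finset.mem_toList.2 (Finset.mem_filter.2 ⟨Finset.mem_univ _, γ, hγ, σ, hσ, rfl⟩)
      · rintro ev hev θ' e ⟨u, v, k', h, -⟩
        obtain ⟨u', -, rfl⟩ := List.mem_map.1 hev
        cases h
  let H : Finset (Sym2 V) :=
    Finset.univ.filter fun e => ∃ h : e ∈ N.graph.edgeSet, E.Carries θ ⟨e, h⟩
  obtain ⟨l₂, hd₂, hc₂, hcl⟩ := exists_spread (N := N) θ k H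
    (fun e he => (Finset.mem_filter.1 he).2.1) (avail B l₁)
  refine ⟨l₁ ++ l₂, hd₁.append hd₂, fun γ hγ σ hσ => ?_, fun θ' e => ?_⟩
  · rw [avail_append]
    refine walk_closed (D := {x | (x, θ, k) ∈ avail (avail B l₁) l₂}) (H := (H : Set (Sym2 V)))
      (fun u v huv hu => hcl u v huv hu) σ.2.2.1 (fun e he => ?_)
      (subset_avail _ _ (hst γ hγ σ hσ))
    exact Finset.mem_filter.2 ⟨Finset.mem_univ _, σ.2.2.1.edges_subset_edgeSet he,
      γ, hγ, σ, hσ, he⟩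
  · rw [List.countP_append, List.countP_eq_zero.2 (by simpa using fun ev h => hc₁ ev h θ' e),
      zero_add]
    refine (hc₂ θ' e).trans (le_of_eq (if_congr ?_ rfl rfl))
    simp only [H, Finset.mem_filter, Finset.mem_univ, true_and, Subtype.coe_eta, Subtype.coe_prop,
      exists_true_left]
    constructor <;> (rintro ⟨rfl, h⟩; exact ⟨rfl, h⟩)

-- Take a maximal set `P` of functions that can be delivered. A function minimal outside `P` in the
-- DAG order has all its predecessors in `P`, so it could be added; hence `P` is everything.
open Classical in
theorem Embedding.exists_derivation [Fintype V] [Finite Ω] (E : Embedding N G) (k : Fin K)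
    {B : Set (V × G.Fn × Fin K)} (hB : ∀ i, (N.s i, G.sourceFn i, k) ∈ B) :
    ∃ l : List (Event V G K), Derivation N B l ∧
      (∀ θ, G.IsTarget θ → (N.t, θ, k) ∈ avail B l) ∧
      ∀ θ (e : N.graph.edgeSet), l.countP (fun ev => ev.Sends θ e) ≤
        if E.Carries θ e then 1 else 0 := by
  let Q : Set (Set G.Fn) := {P | ∃ l : List (Event V G K), Derivation N B l ∧
      (∀ γ, G.tailFn γ ∈ P → ∀ σ ∈ E.1 γ, (σ.finish, G.tailFn γ, k) ∈ avail B l) ∧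
      ∀ θ (e : N.graph.edgeSet), l.countP (fun ev => ev.Sends θ e) ≤
        if θ ∈ P ∧ E.Carries θ e then 1 else 0}
  have hQ : ∅ ∈ Q := ⟨[], trivial, by simp, by simp⟩
  obtain ⟨P, hP⟩ := (Set.toFinite Q).exists_maximal ⟨∅, hQ⟩
  have huniv : P = Set.univ := by
    by_contra hne
    obtain ⟨θ₀, hθ₀⟩ := (Set.ne_univ_iff_exists_notMem P).1 hne
    let wf := InvImage.wf (Subtype.val : G.Fn → Ω) G.wellFounded
    obtain ⟨θ, hθ, hmin⟩ := wf.has_min {θ | θ ∉ P} ⟨θ₀, hθ₀⟩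
    obtain ⟨l, hd, hfin, hc⟩ := hP.prop
    obtain ⟨l', hd', hfin', hc'⟩ := E.exists_derivation_extend k
      (fun i => subset_avail B l (hB i)) θ (fun γ hγ => hfin γ (by
        by_contra h
        exact hmin _ h ⟨γ, rfl, hγ⟩))
    have hins : insert θ P ∈ Q := by
      refine ⟨l ++ l', hd.append hd', fun γ hγ σ hσ => ?_, fun θ' e => ?_⟩
      · rw [avail_append]
        rcases hγ with hγ | hγ
        · rw [hγ]
          exact hfin' γ (congrArg Subtype.val hγ) σ hσ
        · exact subset_avail _ _ (hfin γ hγ σ hσ)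
      · rw [List.countP_append]
        have h₁ := hc θ' e
        have h₂ := hc' θ' e
        by_cases hθ' : θ' = θ
        · subst hθ'
          have hθ'' : θ' ∉ P := hθ
          simp only [hθ'', false_and, if_false, true_and, Set.mem_insert_iff, true_or] at h₁ h₂ ⊢
          omega
        · simp only [hθ', false_and, if_false, Set.mem_insert_iff, false_or] at h₁ h₂ ⊢
          omega
    exact hθ (hP.le_of_ge hins (Set.subset_insert _ _) (Set.mem_insert _ _))
  obtain ⟨l, hd, hfin, hc⟩ := hP.prop
  refine ⟨l, hd, ?_, fun θ e => by simpa [huniv] using hc θ e⟩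
  rintro θ ⟨γ, hγ, hs⟩
  obtain ⟨σ, hσ⟩ := E.2.nonempty γ
  have := hfin γ (by simp [huniv]) σ hσ
  rwa [E.2.sink γ hs σ hσ, show G.tailFn γ = θ from Subtype.ext hγ] at this

/-- Embeddings can be combined to a scheme that uses the `k`-th of them for the symbols with
index `k`. -/
theorem exists_scheme_of_embeddings [Fintype V] [Fintype Ω] (hK : 0 < K)
    (E : Fin K → Embedding N G) :
    ∃ A : Scheme N G, A.K = K ∧ ∀ e, A.linkUsage e ≤ ∑ k, (E k).usage e := by
  classical
  have key : ∀ s : Finset (Fin K), ∃ l : List (Event V G K), Derivation N (sources N G K) l ∧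
      (∀ k ∈ s, ∀ θ, G.IsTarget θ → (N.t, θ, k) ∈ avail (sources N G K) l) ∧
      ∀ θ (e : N.graph.edgeSet), l.countP (fun ev => ev.Sends θ e) ≤
        ∑ k ∈ s, if (E k).Carries θ e then 1 else 0 := by
    intro s
    induction s using Finset.induction_on with
    | empty => exact ⟨[], trivial, by simp, by simp⟩
    | insert k s hk ih =>
      obtain ⟨l, hd, hT, hc⟩ := ih
      obtain ⟨l', hd', hT', hc'⟩ := (E k).exists_derivation k (B := avail (sources N G K) l)
        (fun i => subset_avail _ _ ⟨i, rfl, rfl⟩)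
      refine ⟨l ++ l', hd.append hd', fun j hj θ hθ => ?_, fun θ e => ?_⟩
      · rw [avail_append]
        rcases Finset.mem_insert.1 hj with rfl | hj
        · exact hT' θ hθ
        · exact subset_avail _ _ (hT j hj θ hθ)
      · rw [List.countP_append, Finset.sum_insert hk, add_comm]
        exact add_le_add (by convert hc' θ e) (by convert hc θ e)
  obtain ⟨l, hd, hT, hc⟩ := key Finset.univ
  obtain ⟨A, hA, hAc⟩ := hd.exists_scheme hK (by
    rintro ⟨x, θ, k⟩ ⟨hx, hθ⟩
    dsimp only at hx hθ
    subst hx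
    exact hT k (Finset.mem_univ _) θ hθ)
  refine ⟨A, hA, fun e => ?_⟩
  simp only [Scheme.linkUsage, Embedding.usage]
  rw [Finset.sum_comm]
  refine Finset.sum_le_sum fun θ _ => ?_
  rw [← Finset.sum_mul]
  refine Nat.mul_le_mul_right _ ((hAc θ e).trans ?_)
  convert hc θ e

/-! ### Embeddings from derivations -/

/-- The map `f` assigns to every available symbol (the elements of `B`) the path on which it has
come from the node where it was computed or was present initially (the elements of `A`); `Sent`
holds for the transmissions that have taken place. -/
structure Provenance (N : Network κ V) (A B : Set (V × G.Fn × Fin K))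
    (Sent : G.Fn → Fin K → Sym2 V → Prop) (f : V × G.Fn × Fin K → N.NPath) : Prop where
  finish : ∀ p ∈ B, (f p).finish = p.1
  sent : ∀ p ∈ B, ∀ e ∈ (f p).2.2.1.edges, Sent p.2.1 p.2.2 e
  mem : ∀ p ∈ B, ∀ x ∈ (f p).verts, (x, p.2) ∈ B
  start : ∀ p ∈ B, ∀ x ∈ (f p).verts, (f (x, p.2)).start = (f p).start
  root : ∀ p ∈ B, ((f p).start, p.2) ∈ A ∨ ((∀ i, p.2.1 ≠ G.sourceFn i) ∧
    ∀ η, G.IsPred η p.2.1 → ((f p).start, η, p.2.2) ∈ B)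

/-- The event sends the symbol `(θ, k)` over the link `e`. -/
def Event.SendsAt (ev : Event V G K) (θ : G.Fn) (k : Fin K) (e : Sym2 V) : Prop :=
  ∃ u v, ev = .transmit u v θ k ∧ s(u, v) = e

theorem Provenance.mono {A B : Set (V × G.Fn × Fin K)} {S S' : G.Fn → Fin K → Sym2 V → Prop}
    {f : V × G.Fn × Fin K → N.NPath} (h : Provenance N A B S f)
    (hS : ∀ θ k e, S θ k e → S' θ k e) : Provenance N A B S' f :=
  ⟨h.finish, fun p hp e he => hS _ _ _ (h.sent p hp e he), h.mem, h.start, h.root⟩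

open Classical in
/-- Assign a path to one new symbol. -/
theorem Provenance.update {A B : Set (V × G.Fn × Fin K)} {S : G.Fn → Fin K → Sym2 V → Prop}
    {f : V × G.Fn × Fin K → N.NPath} (h : Provenance N A B S f) {p : V × G.Fn × Fin K}
    (hp : p ∉ B) (σ : N.NPath) (hfin : σ.finish = p.1)
    (hsent : ∀ e ∈ σ.2.2.1.edges, S p.2.1 p.2.2 e)
    (hverts : ∀ x ∈ σ.verts, x ≠ p.1 → (x, p.2) ∈ B ∧ (f (x, p.2)).start = σ.start)
    (hroot : (σ.start, p.2) ∈ A ∨ ((∀ i, p.2.1 ≠ G.sourceFn i) ∧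
      ∀ η, G.IsPred η p.2.1 → (σ.start, η, p.2.2) ∈ B)) :
    Provenance N A (insert p B) S (Function.update f p σ) := by
  have hold : ∀ q ∈ B, Function.update f p σ q = f q := fun q hq =>
    Function.update_of_ne (ne_of_mem_of_not_mem hq hp) _ _
  have hnew : Function.update f p σ p = σ := Function.update_self _ _ _
  constructor
  · rintro q (rfl | hq)
    · rw [hnew, hfin]
    · rw [hold q hq, h.finish q hq]
  · rintro q (rfl | hq)
    · rw [hnew]
      exact hsent
    · rw [hold q hq]
      exact h.sent q hq
  · rintro q (rfl | hq) x hx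
    · rw [hnew] at hx
      by_cases hxq : x = q.1
      · subst hxq
        exact Set.mem_insert _ _
      · exact Or.inr (hverts x hx hxq).1
    · rw [hold q hq] at hx
      exact Or.inr (h.mem q hq x hx)
  · rintro q (rfl | hq) x hx
    · rw [hnew] at hx
      by_cases hxq : x = q.1
      · subst hxq
        rfl
      · rw [hold _ (hverts x hx hxq).1, hnew]
        exact (hverts x hx hxq).2
    · rw [hold q hq] at hx
      rw [hold _ (h.mem q hq x hx), hold q hq]
      exact h.start q hq x hx
  · rintro q (rfl | hq)
    · rw [hnew]
      exact hroot.imp_right fun h' => ⟨h'.1, fun η hη => Or.inr (h'.2 η hη)⟩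
    · rw [hold q hq]
      exact (h.root q hq).imp_right fun h' => ⟨h'.1, fun η hη => Or.inr (h'.2 η hη)⟩

/-- A computed symbol gets the trivial path; a transmitted one prolongs the sender's path by a link.
-/
theorem Provenance.step {A B : Set (V × G.Fn × Fin K)} {S : G.Fn → Fin K → Sym2 V → Prop}
    {f : V × G.Fn × Fin K → N.NPath} (h : Provenance N A B S f) {ev : Event V G K}
    (hl : ev.Legal N) (hin : ev.inputs ⊆ B) :
    ∃ f', Provenance N A (insert ev.output B) (fun θ k e => S θ k e ∨ ev.SendsAt θ k e) f' := by
  classical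
  have h' := h.mono (S' := fun θ k e => S θ k e ∨ ev.SendsAt θ k e) fun _ _ _ => Or.inl
  -- Only the first arrival of a symbol at a node defines its path.
  by_cases hout : ev.output ∈ B
  · rw [Set.insert_eq_of_mem hout]
    exact ⟨f, h'⟩
  cases ev with
  | compute u θ k =>
    refine ⟨_, h'.update hout ⟨u, u, SimpleGraph.Path.nil⟩ rfl ?_ ?_ (Or.inr ⟨hl, ?_⟩)⟩
    · intro e he
      simp [SimpleGraph.Path.nil] at he
    · intro x hx hne
      simp only [Network.NPath.verts, SimpleGraph.Path.nil, SimpleGraph.Walk.support_nil,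
        List.mem_singleton, Set.mem_ofPred_eq] at hx
      exact absurd hx hne
    · intro η hη
      exact hin ⟨rfl, rfl, hη⟩
  | transmit u v θ k =>
    have hu : (u, θ, k) ∈ B := hin ⟨rfl, rfl, rfl⟩
    have hfin := h.finish _ hu
    have hmem := h.mem _ hu
    have hstart := h.start _ hu
    have hsent := h.sent _ hu
    have hroot := h.root _ hu
    generalize f (u, θ, k) = τ at hfin hmem hstart hsent hroot
    obtain ⟨a, b, q, hq⟩ := τ
    obtain rfl : b = u := hfin
    have hadj : N.graph.Adj b v := hl
    -- All nodes of `q` already hold the symbol and `v` does not, so the prolonged walk is still a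
    -- path.
    have hv : v ∉ q.support := fun hv => hout (hmem v hv)
    refine ⟨_, h'.update hout ⟨a, v, q.concat hadj, hq.concat hv hadj⟩ rfl ?_ ?_ ?_⟩
    · intro e he
      simp only [SimpleGraph.Walk.edges_concat, List.concat_eq_append, List.mem_append,
        List.mem_singleton] at he
      rcases he with he | rfl
      · exact Or.inl (hsent e he)
      · exact Or.inr ⟨b, v, rfl, rfl⟩
    · intro x hx hne
      simp only [Network.NPath.verts, SimpleGraph.Walk.support_concat, List.mem_append,
        List.mem_singleton, Set.mem_ofPred_eq] at hx
      have hx' := hx.resolve_right hne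
      exact ⟨hmem x hx', hstart x hx'⟩
    · exact hroot

theorem Derivation.exists_provenance {A B : Set (V × G.Fn × Fin K)}
    {S : G.Fn → Fin K → Sym2 V → Prop} {f : V × G.Fn × Fin K → N.NPath}
    (h : Provenance N A B S f) {l : List (Event V G K)} (hd : Derivation N B l) :
    ∃ f', Provenance N A (avail B l) (fun θ k e => S θ k e ∨ ∃ ev ∈ l, ev.SendsAt θ k e) f' := by
  induction l generalizing B S f with
  | nil => exact ⟨f, by simpa [avail_nil] using h⟩
  | cons ev l ih =>
    obtain ⟨f', hf'⟩ := h.step hd.1 hd.2.1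
    obtain ⟨f'', hf''⟩ := ih hf' hd.2.2
    refine ⟨f'', ?_⟩
    rw [avail_cons]
    refine hf''.mono fun θ k e he => ?_
    simpa [or_assoc] using he

theorem provenance_sources :
    Provenance N (sources N G K) (sources N G K) (fun _ _ _ => False)
      fun p => ⟨p.1, p.1, SimpleGraph.Path.nil⟩ := by
  have hv : ∀ u x, x ∈ Network.NPath.verts (N := N) ⟨u, u, SimpleGraph.Path.nil⟩ → x = u := by
    intro u x hx
    simpa [Network.NPath.verts, SimpleGraph.Path.nil] using hx
  constructor
  · exact fun _ _ => rfl
  · intro p _ e he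
    simp [SimpleGraph.Path.nil] at he
  · intro p hp x hx
    rw [hv _ _ hx]
    exact hp
  · intro p hp x hx
    rw [hv _ _ hx]
  · exact fun p hp => Or.inl hp

/-- `Demand N f k γ v`: to bring the `k`-th target symbols to the sink node on the paths of `f`,
the function of `γ` is needed at `v` as an input of the head of `γ`. -/
inductive Demand (N : Network κ V) {G : CompDAG κ Ω Γ} (f : V × G.Fn × Fin K → N.NPath)
    (k : Fin K) : Γ → V → Prop
  | target (γ : Γ) (h : G.head γ = G.sink) : Demand N f k γ N.t
  | step (γ γ' : Γ) (h : G.head γ = G.tail γ') (v : V) (hv : Demand N f k γ' v) :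
      Demand N f k γ (f (v, G.tailFn γ', k)).start

/-- By `root`, the inputs of a computed symbol are available where its path starts. The alternative,
a source symbol, is excluded because an edge enters its vertex. -/
theorem Demand.mem {B : Set (V × G.Fn × Fin K)} {S : G.Fn → Fin K → Sym2 V → Prop}
    {f : V × G.Fn × Fin K → N.NPath} (h : Provenance N (sources N G K) B S f)
    (hT : targets N G K ⊆ B) {k : Fin K} {γ : Γ} {v : V} (hv : Demand N f k γ v) :
    (v, G.tailFn γ, k) ∈ B := by
  induction hv with
  | target γ hs => exact hT ⟨rfl, γ, rfl, hs⟩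
  | step γ γ' hγ v _ ih =>
    rcases h.root _ ih with ⟨i, -, hi⟩ | ⟨-, hp⟩
    · exact absurd (hγ.trans (congrArg Subtype.val hi)) (G.head_ne_source γ i)
    · exact hp _ ⟨γ, rfl, hγ⟩

theorem Demand.exists_of_edge [Finite Ω] (f : V × G.Fn × Fin K → N.NPath) (k : Fin K) (γ : Γ) :
    ∃ v, Demand N f k γ v := by
  suffices ∀ ω, ∀ γ, G.head γ = ω → ∃ v, Demand N f k γ v from this _ γ rfl
  intro ω
  induction ω using G.wellFounded_swap.induction with
  | _ ω ih =>
  intro γ hγ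
  by_cases hs : G.head γ = G.sink
  · exact ⟨_, .target γ hs⟩
  · obtain ⟨γ', hγ'⟩ := G.exists_tail_eq ⟨G.head γ, hs⟩
    obtain ⟨v, hv⟩ := ih (G.head γ') ⟨γ', hγ'.trans hγ, rfl⟩ γ' rfl
    exact ⟨_, .step γ γ' hγ'.symm v hv⟩

/-- A demanded path raises a demand at its start on every incoming edge (`pred`), and a demand on an
edge not entering the sink was raised by some successor edge (`succ`). A path is determined by its
end. If two paths of one edge share a vertex, the path that `f` assigns there has the start of both,
so their starts agree. -/
theorem Provenance.isEmbedding [Finite Ω] {B : Set (V × G.Fn × Fin K)}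
    {S : G.Fn → Fin K → Sym2 V → Prop} {f : V × G.Fn × Fin K → N.NPath}
    (h : Provenance N (sources N G K) B S f) (hT : targets N G K ⊆ B) (k : Fin K) :
    IsEmbedding N G fun γ => {σ | ∃ v, Demand N f k γ v ∧ f (v, G.tailFn γ, k) = σ} := by
  constructor
  · intro γ
    obtain ⟨v, hv⟩ := Demand.exists_of_edge (N := N) f k γ
    exact ⟨_, v, hv, rfl⟩
  · rintro γ i hi _ ⟨v, hv, rfl⟩
    rcases h.root _ (hv.mem h hT) with ⟨j, hj, hij⟩ | ⟨hns, -⟩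
    · have : i = j := G.source_injective (hi.symm.trans (congrArg Subtype.val hij))
      rw [this]
      exact hj.symm
    · exact absurd (Subtype.ext hi) (hns i)
  · rintro γ hs _ ⟨v, hv, rfl⟩
    rw [h.finish _ (hv.mem h hT)]
    cases hv with
    | target => rfl
    | step γ γ' hγ v hv => exact absurd (hγ.symm.trans hs) (G.tailFn γ').2
  · rintro γ γ' hγ _ ⟨v, hv, rfl⟩
    have hd := Demand.step γ' γ hγ v hv
    exact ⟨_, ⟨_, hd, rfl⟩, h.finish _ (hd.mem h hT)⟩
  · rintro γ' hs _ ⟨v, hv, rfl⟩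
    rw [h.finish _ (hv.mem h hT)]
    cases hv with
    | target _ hs' => exact absurd hs' hs
    | step _ γ hγ v hv => exact ⟨γ, hγ.symm, _, ⟨v, hv, rfl⟩, rfl⟩
  · rintro γ _ ⟨v, hv, rfl⟩ _ ⟨v', hv', rfl⟩ hfin
    rw [h.finish _ (hv.mem h hT), h.finish _ (hv'.mem h hT)] at hfin
    dsimp only at hfin
    rw [hfin]
  · rintro γ _ ⟨v, hv, rfl⟩ _ ⟨v', hv', rfl⟩ hne
    rw [Set.disjoint_left]
    intro x hx hx'
    exact hne ((h.start _ (hv.mem h hT) x hx).symm.trans (h.start _ (hv'.mem h hT) x hx'))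

/-- A scheme yields an embedding for each symbol index, and together they use each link at most as
often as the scheme. -/
theorem Scheme.exists_embeddings [Fintype Ω] (A : Scheme N G) :
    ∃ E : Fin A.K → Embedding N G, ∀ e, ∑ k, (E k).usage e ≤ A.linkUsage e := by
  classical
  obtain ⟨hd, hfin⟩ := A.run.derivation (B := sources N G A.K) fun x p hp => hp
  have hT : targets N G A.K ⊆ avail (sources N G A.K) A.events := fun p hp => hfin p.1 p.2 hp
  obtain ⟨f, hf⟩ := hd.exists_provenance provenance_sources
  refine ⟨fun k => ⟨_, hf.isEmbedding hT k⟩, fun e => ?_⟩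
  simp only [Scheme.linkUsage, Embedding.usage]
  rw [Finset.sum_comm]
  refine Finset.sum_le_sum fun θ _ => ?_
  rw [← Finset.sum_mul]
  refine Nat.mul_le_mul_right _ ?_
  -- Send each transmission of `θ` over `e` to its index. Every `k` whose embedding carries `θ` on
  -- `e` is hit, so there are at most as many such `k` as transmissions.
  rw [← Finset.sum_filter, Finset.sum_const, smul_eq_mul, mul_one, List.countP_eq_length_filter,
    ← List.length_map (f := Event.index)]
  refine le_trans (Finset.card_le_card ?_) (List.toFinset_card_le _)
  intro k hk
  obtain ⟨γ, hγ, _, ⟨v, hv, rfl⟩, he⟩ := (Finset.mem_filter.1 hk).2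
  rcases hf.sent _ (hv.mem hf hT) _ he with h | ⟨ev, hev, a, b, rfl, hab⟩
  · exact h.elim
  · rw [List.mem_toFinset]
    refine List.mem_map.2 ⟨_, List.mem_filter.2 ⟨hev, decide_eq_true ⟨a, b, k, ?_, hab⟩⟩, rfl⟩
    rw [show G.tailFn γ = θ from Subtype.ext hγ]

/-! ### The linear program and the capacity -/

section CALP

variable [Fintype V] [Fintype Ω] [Fintype Γ]

theorem IsCALPFeasible.ofReal_le {x : Embedding N G → ℝ} (hx : IsCALPFeasible N G x) :
    ENNReal.ofReal (∑ E, x E) ≤ calpValue N G :=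
  le_iSup₂ (f := fun (x : Embedding N G → ℝ) (_ : IsCALPFeasible N G x) =>
    ENNReal.ofReal (∑ E, x E)) x hx

/-- An integral packing of embeddings can be realized by a scheme. -/
theorem exists_scheme_of_multiplicities (n : Embedding N G → ℕ) (hn : 0 < ∑ E, n E) :
    ∃ A : Scheme N G, A.K = ∑ E, n E ∧ ∀ e, A.linkUsage e ≤ ∑ E, E.usage e * n E := by
  have hcard : Fintype.card ((E : Embedding N G) × Fin (n E)) = ∑ E, n E := by simp
  let φ : Fin (∑ E, n E) ≃ (E : Embedding N G) × Fin (n E) :=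
    (Fintype.equivFinOfCardEq hcard).symm
  obtain ⟨A, hA, hu⟩ := exists_scheme_of_embeddings hn fun k => (φ k).1
  refine ⟨A, hA, fun e => (hu e).trans (le_of_eq ?_)⟩
  rw [Equiv.sum_comp φ fun z => z.1.usage e, Fintype.sum_sigma]
  simp [mul_comm]

theorem IsCALPFeasible.achievable [Nonempty (Embedding N G)] {x : Embedding N G → ℝ}
    (hx : IsCALPFeasible N G x) : Achievable N G (∑ E, x E) := by
  intro ε hε
  rcases le_or_gt (∑ E, x E) ε with hle | hlt
  -- The required rate is not positive, so any scheme will do.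
  · obtain ⟨E⟩ := ‹Nonempty (Embedding N G)›
    obtain ⟨A, -, -⟩ := exists_scheme_of_embeddings one_pos fun _ => E
    exact ⟨A, fun e => (mul_nonpos_of_nonneg_of_nonpos (Nat.cast_nonneg _) (by linarith)).trans
      (mul_nonneg (Nat.cast_nonneg _) (N.c_nonneg e))⟩
  · obtain ⟨M, hM⟩ := exists_nat_gt (Fintype.card (Embedding N G) / ε : ℝ)
    rw [div_lt_iff₀ hε] at hM
    have hK : (M : ℝ) * (∑ E, x E - ε) < ((∑ E, ⌊M * x E⌋₊ : ℕ) : ℝ) := by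
      have : ∑ E, (M * x E - 1) ≤ ∑ E, (⌊M * x E⌋₊ : ℝ) :=
        Finset.sum_le_sum fun E _ => (Nat.sub_one_lt_floor _).le
      rw [Finset.sum_sub_distrib, ← Finset.mul_sum] at this
      simp only [Finset.sum_const, Finset.card_univ, nsmul_eq_mul, mul_one] at this
      push_cast
      linarith
    have hpos : 0 < ∑ E, ⌊M * x E⌋₊ := by
      have : (0 : ℝ) ≤ M * (∑ E, x E - ε) := mul_nonneg (Nat.cast_nonneg _) (by linarith)
      exact_mod_cast this.trans_lt hK
    obtain ⟨A, hA, hu⟩ := exists_scheme_of_multiplicities _ hpos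
    refine ⟨A, fun e => ?_⟩
    have hu' : (A.linkUsage e : ℝ) ≤ M * N.c e := by
      calc (A.linkUsage e : ℝ) ≤ ((∑ E : Embedding N G, E.usage e * ⌊M * x E⌋₊ : ℕ) : ℝ) := by
            exact_mod_cast hu e
        _ ≤ ∑ E : Embedding N G, M * ((E.usage e : ℝ) * x E) := by
            push_cast
            refine Finset.sum_le_sum fun E _ => ?_
            rw [mul_left_comm]
            exact mul_le_mul_of_nonneg_left
              (Nat.floor_le (mul_nonneg (Nat.cast_nonneg _) (hx.nonneg E))) (Nat.cast_nonneg _)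
        _ ≤ M * N.c e := by
            rw [← Finset.mul_sum]
            exact mul_le_mul_of_nonneg_left (hx.capacity e) (Nat.cast_nonneg _)
    calc (A.linkUsage e : ℝ) * (∑ E, x E - ε) ≤ M * N.c e * (∑ E, x E - ε) :=
          mul_le_mul_of_nonneg_right hu' (by linarith)
      _ = M * (∑ E, x E - ε) * N.c e := by ring
      _ ≤ A.K * N.c e := by
          rw [hA]
          exact mul_le_mul_of_nonneg_right hK.le (N.c_nonneg e)

theorem calpValue_le_computingCapacity : calpValue N G ≤ computingCapacity N G := by
  refine iSup₂_le fun x hx => ?_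
  cases isEmpty_or_nonempty (Embedding N G)
  · simp
  · exact le_iSup₂ (f := fun (r : ℝ) (_ : Achievable N G r) => ENNReal.ofReal r) _ hx.achievable

/-- The packing obtained from a scheme. -/
theorem Scheme.exists_feasible (A : Scheme N G) {r : ℝ} (hr : 0 ≤ r)
    (hA : ∀ e, (A.linkUsage e : ℝ) * r ≤ A.K * N.c e) :
    ∃ x : Embedding N G → ℝ, IsCALPFeasible N G x ∧ ∑ E, x E = r := by
  classical
  obtain ⟨E, hE⟩ := A.exists_embeddings
  have hK : (0 : ℝ) < A.K := Nat.cast_pos.2 A.K_pos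
  -- An embedding that arises from several indices collects the weight `r / A.K` from each.
  refine ⟨fun F => ∑ k, if E k = F then r / A.K else 0, ⟨fun e => ?_, fun F => ?_⟩, ?_⟩
  · have : ∑ F : Embedding N G, (F.usage e : ℝ) * ∑ k, (if E k = F then r / A.K else 0) =
        (∑ k, ((E k).usage e : ℝ)) * (r / A.K) := by
      simp only [Finset.mul_sum, mul_ite, mul_zero]
      rw [Finset.sum_comm]
      simp [Finset.sum_mul]
    rw [this, ← mul_div_assoc, div_le_iff₀ hK, mul_comm (N.c e)]
    refine le_trans (mul_le_mul_of_nonneg_right ?_ hr) (hA e)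
    exact_mod_cast hE e
  · exact Finset.sum_nonneg fun k _ => by split_ifs <;> positivity
  · rw [Finset.sum_comm]
    simp [mul_div_cancel₀ r hK.ne']

theorem computingCapacity_le_calpValue : computingCapacity N G ≤ calpValue N G := by
  refine iSup₂_le fun r hr => ?_
  refine ENNReal.le_of_forall_pos_le_add fun ε hε _ => ?_
  have hε' : (0 : ℝ) < ε := hε
  obtain ⟨A, hA⟩ := hr ε hε'
  -- `Scheme.exists_feasible` needs a nonnegative rate; if `r ≤ ε`, the error term alone suffices.
  rcases le_or_gt r ε with hle | hlt
  · refine le_trans ?_ le_add_self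
    rw [← ENNReal.ofReal_coe_nnreal]
    exact ENNReal.ofReal_le_ofReal hle
  · obtain ⟨x, hx, hsum⟩ := A.exists_feasible (sub_nonneg.2 hlt.le) hA
    have := hx.ofReal_le
    rw [hsum] at this
    calc ENNReal.ofReal r = ENNReal.ofReal (r - ε) + ENNReal.ofReal ε := by
          rw [← ENNReal.ofReal_add (sub_nonneg.2 hlt.le) hε'.le, sub_add_cancel]
      _ ≤ _ := by
          rw [ENNReal.ofReal_coe_nnreal]
          gcongr

theorem calpValue_eq_computingCapacity : calpValue N G = computingCapacity N G :=
  le_antisymm calpValue_le_computingCapacity computingCapacity_le_calpValue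

/-- If the linear program is bounded, every embedding uses some link. -/
theorem exists_usage_pos (h : calpValue N G ≠ ⊤) (E : Embedding N G) : ∃ e, 0 < E.usage e := by
  classical
  by_contra! hE
  refine h (ENNReal.eq_top_of_forall_nnreal_le fun r => ?_)
  -- An embedding that uses no link can carry any weight at no cost.
  have hx : IsCALPFeasible N G (Pi.single E (r : ℝ)) := by
    refine ⟨fun e => ?_, fun F => ?_⟩
    · refine le_trans (le_of_eq (Finset.sum_eq_zero fun F _ => ?_)) (N.c_nonneg e)
      by_cases hF : F = E
      · subst hF
        simp [Nat.le_zero.1 (hE e)]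
      · simp [hF]
    · by_cases hF : F = E
      · subst hF
        simp
      · simp [hF]
  simpa using hx.ofReal_le

/-- Each embedding has integral usage at least one on some link, whose capacity bounds its weight.
So the feasible set is a closed subset of a box. -/
theorem isCompact_feasible (h : calpValue N G ≠ ⊤) : IsCompact {x | IsCALPFeasible N G x} := by
  choose e he using exists_usage_pos h
  refine (isCompact_univ_pi fun E : Embedding N G =>
    isCompact_Icc (a := (0 : ℝ)) (b := N.c (e E))).of_isClosed_subset ?_ ?_
  · have : {x | IsCALPFeasible N G x} =
        (⋂ e, {x | ∑ E, (E.usage e : ℝ) * x E ≤ N.c e}) ∩ ⋂ E, {x | 0 ≤ x E} := by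
      ext x
      simp only [Set.mem_ofPred_eq, Set.mem_inter_iff, Set.mem_iInter]
      exact ⟨fun hx => ⟨hx.capacity, hx.nonneg⟩, fun hx => ⟨hx.1, hx.2⟩⟩
    rw [this]
    refine IsClosed.inter (isClosed_iInter fun e => ?_) (isClosed_iInter fun E => ?_)
    · exact isClosed_le (by fun_prop) continuous_const
    · exact isClosed_le continuous_const (by fun_prop)
  · intro x hx E _
    refine ⟨hx.nonneg E, ?_⟩
    calc x E ≤ (E.usage (e E) : ℝ) * x E :=
          le_mul_of_one_le_left (hx.nonneg E) (by exact_mod_cast he E)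
      _ ≤ ∑ F, (F.usage (e E) : ℝ) * x F :=
          Finset.single_le_sum (f := fun F : Embedding N G => (F.usage (e E) : ℝ) * x F)
            (fun F _ => mul_nonneg (Nat.cast_nonneg _) (hx.nonneg F)) (Finset.mem_univ E)
      _ ≤ N.c (e E) := hx.capacity _

theorem exists_optimal (h : calpValue N G ≠ ⊤) :
    ∃ x : Embedding N G → ℝ, IsCALPFeasible N G x ∧
      ENNReal.ofReal (∑ E, x E) = calpValue N G := by
  have h0 : IsCALPFeasible N G 0 := ⟨fun e => by simpa using N.c_nonneg e, fun _ => le_rfl⟩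
  obtain ⟨x, hx, hmax⟩ := (isCompact_feasible h).exists_isMaxOn ⟨0, h0⟩
    (f := fun x : Embedding N G → ℝ => ∑ E, x E) (by fun_prop)
  exact ⟨x, hx, le_antisymm (IsCALPFeasible.ofReal_le hx)
    (iSup₂_le fun y hy => ENNReal.ofReal_le_ofReal (hmax hy))⟩

end CALP

end InNetwork

theorem theorem1 {κ : ℕ} {V Ω Γ : Type*} [Fintype V] [Fintype Ω] [Fintype Γ]
    (N : InNetwork.Network κ V) (G : InNetwork.CompDAG κ Ω Γ) :
    InNetwork.calpValue N G = InNetwork.computingCapacity N G ∧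
      (InNetwork.computingCapacity N G ≠ ⊤ →
        ∃ x : InNetwork.Embedding N G → ℝ, InNetwork.IsCALPFeasible N G x ∧
          ENNReal.ofReal (∑ E, x E) = InNetwork.computingCapacity N G) := by
  rw [← InNetwork.calpValue_eq_computingCapacity]
  exact ⟨rfl, InNetwork.exists_optimal⟩
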